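/- Let $p$ be a prime number such that $p-2$ is also prime, and let $E_p$ be the elliptic curve over $\mathbb{Q}$ defined by $y^2 = x(x-p)(x-2)$. (a) If $p \equiv 7 \pmod 8$, then $E_p(\mathbb{Q})$ is a finitely generated abelian group of rank $0$; more precisely, $$E_p(\mathbb{Q}) \cong \mathbb{Z}/2\mathbb{Z} \times \mathbb{Z}/2\mathbb{Z}.$$ (b) If $p \equiv 5 \pmod 8$, then $E_p(\mathbb{Q})$ is a finitely generated abelian group of rank at most $1$; more precisely, either $$E_p(\mathbb{Q}) \cong \mathbb{Z}/2\mathbb{Z} \times \mathbb{Z}/2\mathbb{Z} \quad\text{or}\quad E_p(\mathbb{Q}) \cong \mathbb{Z} \times \mathbb{Z}/2\mathbb{Z} \times \mathbb{Z}/2\mathbb{Z}.$$ -/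

import Mathlib

/-- The Weierstrass curve `y² = x (x - p) (x - 2) = x³ - (p + 2) x² + 2 p x` over `ℚ`. -/
def beersCurve (p : ℕ) : WeierstrassCurve ℚ where
  a₁ := 0
  a₂ := -((p : ℚ) + 2)
  a₃ := 0
  a₄ := 2 * (p : ℚ)
  a₆ := 0

/-- The affine equation of `beersCurve p` is `y² = x (x - p) (x - 2)`. -/
theorem beersCurve_equation_iff (p : ℕ) (x y : ℚ) :
    (beersCurve p).toAffine.Equation x y ↔ y ^ 2 = x * (x - p) * (x - 2) := by
  rw [WeierstrassCurve.Affine.equation_iff]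
  simp only [beersCurve]
  constructor <;> intro h <;> linear_combination h

/-- For `p ≠ 0, 2` the curve `beersCurve p` is an elliptic curve. -/
theorem beersCurve_isElliptic (p : ℕ) (h0 : p ≠ 0) (h2 : p ≠ 2) :
    (beersCurve p).IsElliptic := by
  have hΔ : (beersCurve p).Δ = 64 * ((p : ℚ) * ((p : ℚ) - 2)) ^ 2 := by
    simp only [beersCurve, WeierstrassCurve.Δ, WeierstrassCurve.b₂, WeierstrassCurve.b₄,
      WeierstrassCurve.b₆, WeierstrassCurve.b₈]
    ring
  have h0' : (p : ℚ) ≠ 0 := by exact_mod_cast h0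
  have h2' : (p : ℚ) - 2 ≠ 0 := sub_ne_zero.mpr (by exact_mod_cast h2)
  refine ⟨?_⟩
  rw [hΔ, isUnit_iff_ne_zero]
  positivity

/-- The Mordell-Weil group `E_p(ℚ)`: the rational points of `y² = x (x - p) (x - 2)` together with
the point at infinity, under the chord-and-tangent group law. -/
abbrev BeersGroup (p : ℕ) : Type := (beersCurve p).toAffine.Point

/-!
Write `E` for the curve `y² = x (x - p) (x - 2)`, whose roots `0`, `p`, `2` give the four rational
points of order dividing two, and let `q = p - 2`. Everything comes from the quotient `E(ℚ) / 2 E(ℚ)`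
and from the `2`-adic behaviour of doubling.

*Torsion.* If `(x, y)` is a double, then `x` and `x - 2` are squares; the squares differ by `2`, which
forces `x` to be nonintegral at `2`. For such a point doubling lowers the `2`-adic valuation of `x` by
exactly `2`, so that a nonzero double has infinite order. Hence the torsion subgroup is `E[2]`, a Klein
four-group (`add_self_eq_zero_of_isOfFinAddOrder`).

*Descent.* Since `x > 0` and the differences of the roots are `p`, `2`, `q`, the number `x` is `1`, `2`,
`p` or `2 p` up to squares, and a translation by a point of `E[2]` makes it a square
(`exists_add_eq_isSquare`). Then `x - p` and `x - 2` are in the same class modulo squares, that of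
one of `±1`, `±q`. Because `q ≡ 3, 5 [MOD 8]`, the number `2` is not a square modulo `q`, which excludes
`±q`; and for `p ≡ 7 [MOD 8]` the number `-1` is not a square modulo `p`, which excludes `-1`
(`isSquare_or_neg_of_isSquare`). A point at which `x`, `x - p` and `x - 2` are all squares is a
double (`exists_add_self_of_squares`), and two points in the class of `-1` differ by a double. So
`E(ℚ)` is `E[2] + 2 E(ℚ)` if `p ≡ 7 [MOD 8]`, and is covered by this subgroup and one of its cosets if
`p ≡ 5 [MOD 8]` (`exists_two_classes`).

*Finite generation.* The naive height satisfies the approximate parallelogram law, because the pair of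
`x`-coordinates of `P + Q` and `P - Q` is obtained from that of `P` and `Q` by a quadratic morphism of
`ℙ²`, and it has the Northcott property. Together with the finiteness of `E(ℚ) / 2 E(ℚ)` this gives
finite generation. The quotient by torsion is therefore free of finite rank, and the number of classes
modulo doubling bounds the rank by `0` or `1`.
-/

/-! ### The approximate parallelogram law for the naive height -/

namespace WeierstrassCurve.Affine.Point

open Height

section Field

variable {F : Type*} [Field F]

/-- The numerator of the duplication formula for `x`; here `n / d` is the slope of the tangent. -/
lemma duplication_identity {a₁ a₂ a₃ a₄ a₆ x y d n : F}
    (e : y ^ 2 + a₁ * x * y + a₃ * y = x ^ 3 + a₂ * x ^ 2 + a₄ * x + a₆)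
    (hd : d = y - (-y - a₁ * x - a₃)) (hn : n = 3 * x ^ 2 + 2 * a₂ * x + a₄ - a₁ * y) :
    (x * x) ^ 2 - (2 * a₄ + a₁ * a₃) * (x * x) - (a₃ ^ 2 + 4 * a₆) * (x + x) -
      (a₁ ^ 2 * a₆ + 4 * a₂ * a₆ - a₁ * a₃ * a₄ + a₂ * a₃ ^ 2 - a₄ ^ 2) =
    n ^ 2 + a₁ * n * d - (a₂ + 2 * x) * d ^ 2 := by
  grind

/-- The sum of the `x`-coordinates of `P + Q` and `P - Q`, with `z` the inverse of `x₁ - x₂`. -/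
lemma add_x_add_sub_x_identity {a₁ a₂ a₃ a₄ a₆ x₁ x₂ y₁ y₂ z : F}
    (e₁ : y₁ ^ 2 + a₁ * x₁ * y₁ + a₃ * y₁ = x₁ ^ 3 + a₂ * x₁ ^ 2 + a₄ * x₁ + a₆)
    (e₂ : y₂ ^ 2 + a₁ * x₂ * y₂ + a₃ * y₂ = x₂ ^ 3 + a₂ * x₂ ^ 2 + a₄ * x₂ + a₆)
    (hz : z * (x₁ - x₂) = 1) :
    2 * (x₁ + x₂) * (x₁ * x₂) + (a₁ ^ 2 + 4 * a₂) * (x₁ * x₂) +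
      (2 * a₄ + a₁ * a₃) * (x₁ + x₂) + (a₃ ^ 2 + 4 * a₆) =
    (x₁ - x₂) ^ 2 * ((((y₁ - y₂) * z) ^ 2 + a₁ * ((y₁ - y₂) * z) - a₂ - x₁ - x₂) +
      (((y₁ - (-y₂ - a₁ * x₂ - a₃)) * z) ^ 2 + a₁ * ((y₁ - (-y₂ - a₁ * x₂ - a₃)) * z) -
        a₂ - x₁ - x₂)) := by
  grind

set_option maxHeartbeats 1000000 in
/-- The product of the `x`-coordinates of `P + Q` and `P - Q`, with `z` the inverse of `x₁ - x₂`. -/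
lemma add_x_mul_sub_x_identity {a₁ a₂ a₃ a₄ a₆ x₁ x₂ y₁ y₂ z : F}
    (e₁ : y₁ ^ 2 + a₁ * x₁ * y₁ + a₃ * y₁ = x₁ ^ 3 + a₂ * x₁ ^ 2 + a₄ * x₁ + a₆)
    (e₂ : y₂ ^ 2 + a₁ * x₂ * y₂ + a₃ * y₂ = x₂ ^ 3 + a₂ * x₂ ^ 2 + a₄ * x₂ + a₆)
    (hz : z * (x₁ - x₂) = 1) :
    (x₁ * x₂) ^ 2 - (2 * a₄ + a₁ * a₃) * (x₁ * x₂) - (a₃ ^ 2 + 4 * a₆) * (x₁ + x₂) -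
      (a₁ ^ 2 * a₆ + 4 * a₂ * a₆ - a₁ * a₃ * a₄ + a₂ * a₃ ^ 2 - a₄ ^ 2) =
    (x₁ - x₂) ^ 2 * ((((y₁ - y₂) * z) ^ 2 + a₁ * ((y₁ - y₂) * z) - a₂ - x₁ - x₂) *
      (((y₁ - (-y₂ - a₁ * x₂ - a₃)) * z) ^ 2 + a₁ * ((y₁ - (-y₂ - a₁ * x₂ - a₃)) * z) -
        a₂ - x₁ - x₂)) := by
  grind

variable {W : WeierstrassCurve.Affine F}

lemma addSubMap_eval (v : Fin 3 → F) :
    (fun i ↦ (addSubMap W i).eval v) =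
      ![v 0 ^ 2 - W.b₄ * v 0 * v 2 - W.b₆ * v 1 * v 2 - W.b₈ * v 2 ^ 2,
        2 * v 1 * v 0 + W.b₂ * v 0 * v 2 + W.b₄ * v 1 * v 2 + W.b₆ * v 2 ^ 2,
        v 1 ^ 2 - 4 * v 0 * v 2] := by
  ext i
  fin_cases i <;> simp [addSubMap]

variable [DecidableEq F]

/-- The case `P = Q` of `exists_addSubMap_sym2x`. -/
lemma exists_addSubMap_sym2x_self [WeierstrassCurve.IsElliptic W] (P : W.Point) :
    ∃ c : F, c ≠ 0 ∧
      (fun i ↦ (addSubMap W i).eval (P.sym2x P)) = c • (P + P).sym2x (P - P) := by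
  rw [sub_self]
  rcases P with _ | ⟨x, y, h⟩
  · refine ⟨1, one_ne_zero, ?_⟩
    rw [← zero_def, zero_add, addSubMap_eval]
    simp
  have e := (W.equation_iff _ _).mp h.1
  have h0 := addSubMap_ne_zero W (sym2x_ne_zero (some x y h) (some x y h))
  have h1 : 2 * (x + x) * (x * x) + W.b₂ * (x * x) * 1 + W.b₄ * (x + x) * 1 + W.b₆ * 1 ^ 2 =
      (y - W.negY x y) ^ 2 := by
    simp only [b₂, b₄, b₆, negY]
    linear_combination (-4) * e
  rw [addSubMap_eval] at h0 ⊢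
  simp only [sym2x_some_some, Matrix.cons_val_zero, Matrix.cons_val_one, Matrix.cons_val] at h0 ⊢
  rw [h1] at h0 ⊢
  have h2 : (x + x) ^ 2 - 4 * (x * x) * 1 = 0 := by ring
  rw [h2] at h0 ⊢
  by_cases hy : y = W.negY x y
  · have hy' : y - W.negY x y = 0 := sub_eq_zero.mpr hy
    rw [hy', zero_pow two_ne_zero] at h0 ⊢
    refine ⟨(x * x) ^ 2 - W.b₄ * (x * x) * 1 - W.b₆ * (x + x) * 1 - W.b₈ * 1 ^ 2,
      fun h ↦ h0 (by rw [h]; simp), ?_⟩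
    rw [add_self_of_Y_eq hy, sym2x_zero_zero, Matrix.smul_cons, Matrix.smul_cons,
      Matrix.smul_cons, Matrix.smul_empty, smul_zero, smul_eq_mul]
    simp only [mul_one]
  · have hy' : y - W.negY x y ≠ 0 := sub_ne_zero.mpr hy
    refine ⟨(y - W.negY x y) ^ 2, pow_ne_zero 2 hy', ?_⟩
    rw [add_self_of_Y_ne hy, sym2x_some_zero, slope_of_Y_ne rfl hy, addX]
    have key := duplication_identity e (d := y - W.negY x y) rfl rfl
    have e0 : (x * x) ^ 2 - W.b₄ * (x * x) * 1 - W.b₆ * (x + x) * 1 - W.b₈ * 1 ^ 2 =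
      (y - W.negY x y) ^ 2 * (((3 * x ^ 2 + 2 * W.a₂ * x + W.a₄ - W.a₁ * y) / (y - W.negY x y)) ^ 2
        + W.a₁ * ((3 * x ^ 2 + 2 * W.a₂ * x + W.a₄ - W.a₁ * y) / (y - W.negY x y))
        - W.a₂ - x - x) := by
      simp only [b₄, b₆, b₈]
      generalize 3 * x ^ 2 + 2 * W.a₂ * x + W.a₄ - W.a₁ * y = n at *
      generalize y - W.negY x y = d at *
      field_simp
      linear_combination key
    rw [e0]
    simp

/-- The quadratic map `addSubMap` on `ℙ²` describes how the unordered pair of `x`-coordinates of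
`(P, Q)` determines that of `(P + Q, P - Q)`. -/
lemma exists_addSubMap_sym2x [WeierstrassCurve.IsElliptic W] (P Q : W.Point) :
    ∃ c : F, c ≠ 0 ∧
      (fun i ↦ (addSubMap W i).eval (P.sym2x Q)) = c • (P + Q).sym2x (P - Q) := by
  rcases P with _ | ⟨x₁, y₁, h₁⟩
  · refine ⟨1, one_ne_zero, ?_⟩
    rw [← zero_def, zero_add, zero_sub, sym2x_neg_right, addSubMap_eval]
    rcases Q with _ | ⟨x₂, y₂, h₂⟩
    · simp [← zero_def]
    · simp [sq, two_mul]
  rcases Q with _ | ⟨x₂, y₂, h₂⟩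
  · refine ⟨1, one_ne_zero, ?_⟩
    rw [← zero_def, add_zero, sub_zero, addSubMap_eval]
    simp [sq, two_mul]
  have e₁ := (W.equation_iff _ _).mp h₁.1
  have e₂ := (W.equation_iff _ _).mp h₂.1
  by_cases hx : x₁ = x₂
  · rcases X_eq_iff (h₁ := h₁) (h₂ := h₂) |>.mp hx with h | h
    · rw [h]; exact exists_addSubMap_sym2x_self _
    · obtain ⟨c, hc, H⟩ := exists_addSubMap_sym2x_self (some x₂ y₂ h₂)
      refine ⟨c, hc, ?_⟩
      rw [h, sym2x_neg_left, H, neg_add_cancel, ← neg_add', sym2x_neg_right, sym2x_comm, sub_self]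
  · have hx' : x₁ - x₂ ≠ 0 := sub_ne_zero.mpr hx
    have hz : (x₁ - x₂)⁻¹ * (x₁ - x₂) = 1 := inv_mul_cancel₀ hx'
    refine ⟨(x₁ - x₂) ^ 2, pow_ne_zero 2 hx', ?_⟩
    have key₁ := add_x_add_sub_x_identity e₁ e₂ hz
    have key₂ := add_x_mul_sub_x_identity e₁ e₂ hz
    rw [sub_eq_add_neg (some x₁ y₁ h₁), neg_some, add_of_X_ne hx, add_of_X_ne hx, addSubMap_eval]
    simp only [sym2x_some_some, slope_of_X_ne hx, addX, negY, Matrix.cons_val_zero,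
      Matrix.cons_val_one, Matrix.cons_val, Matrix.smul_cons, Matrix.smul_empty, smul_eq_mul,
      div_eq_mul_inv]
    rw [← key₁, ← key₂, b₂, b₄, b₆, b₈]
    congr 1
    · ring
    congr 1
    · ring
    congr 1
    ring

end Field

section Height

variable {K : Type*} [Field K] [AdmissibleAbsValues K] {W : WeierstrassCurve.Affine K}

/-- The approximate parallelogram law for the naive height `P ↦ logHeight P.xRep`. -/
theorem abs_logHeight_xRep_add_sub_le [DecidableEq K] [WeierstrassCurve.IsElliptic W] :
    ∃ C, ∀ P Q : W.Point, |logHeight (P + Q).xRep + logHeight (P - Q).xRep -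
      2 * (logHeight P.xRep + logHeight Q.xRep)| ≤ C := by
  obtain ⟨C₁, hC₁⟩ := abs_logHeight_addSubMap_sub_two_mul_logHeight_le W
  obtain ⟨C₂, hC₂⟩ := abs_logHeight_sym2_sub_le K
  have hsym (P Q : W.Point) :
      |logHeight (P.sym2x Q) - (logHeight P.xRep + logHeight Q.xRep)| ≤ C₂ := by
    have hvec (R : W.Point) : R.xRep = ![R.xRep 0, R.xRep 1] := by
      ext i; fin_cases i <;> rfl
    have := hC₂ (hvec P ▸ xRep_ne_zero P) (hvec Q ▸ xRep_ne_zero Q)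
    rwa [← hvec, ← hvec] at this
  refine ⟨C₁ + 3 * C₂, fun P Q ↦ ?_⟩
  obtain ⟨c, hc, H⟩ := exists_addSubMap_sym2x P Q
  have h₁ := hC₁ (P.sym2x Q)
  rw [H, logHeight_smul_eq_logHeight _ hc] at h₁
  have h₂ := hsym P Q
  have h₃ := hsym (P + Q) (P - Q)
  rw [abs_le] at *
  constructor <;> linarith

/-- Only finitely many points have bounded naive height, since each value of `x` is taken by at
most two points. -/
theorem northcott_logHeight_xRep [Northcott (logHeight₁ (K := K))] :
    Northcott fun P : W.Point ↦ logHeight P.xRep where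
  finite_le b := by
    have hfin : (insert ![1, 0] ((fun x : K ↦ ![x, 1]) '' {x | logHeight₁ x ≤ b})).Finite :=
      ((Northcott.finite_le b).image _).insert _
    refine Set.Finite.of_finite_fibers (f := fun P : W.Point ↦ P.xRep) (hfin.subset ?_) ?_
    · rintro _ ⟨P, hP, rfl⟩
      rcases P with _ | ⟨x, y, h⟩
      · exact .inl rfl
      · refine .inr ⟨x, ?_, rfl⟩
        simpa [logHeight₁_eq_logHeight] using hP
    · rintro _ ⟨P, -, rfl⟩
      refine (Set.toFinite {P, -P}).subset fun Q hQ ↦ ?_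
      exact eq_or_eq_neg_of_xRep_eq_xRep hQ.2

end Height

end WeierstrassCurve.Affine.Point

/-! ### The group law on `y² = x (x - p) (x - 2)` -/

open WeierstrassCurve.Affine.Point (some add_self_of_Y_eq add_self_of_Y_ne add_of_X_ne zero_def
  some_ne_zero X_eq_iff)

namespace BeersGroup

variable {p : ℕ}

lemma equation_of_nonsingular {x y : ℚ} (h : (beersCurve p).toAffine.Nonsingular x y) :
    y ^ 2 = x * (x - p) * (x - 2) :=
  (beersCurve_equation_iff p x y).mp h.1

lemma nonsingular_of_equation [(beersCurve p).IsElliptic] {x y : ℚ}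
    (h : y ^ 2 = x * (x - p) * (x - 2)) : (beersCurve p).toAffine.Nonsingular x y :=
  WeierstrassCurve.Affine.equation_iff_nonsingular.mp ((beersCurve_equation_iff p x y).mpr h)

lemma natCast_ne_zero [h : (beersCurve p).IsElliptic] : (p : ℚ) ≠ 0 := fun h0 ↦
  h.isUnit.ne_zero <| by
    simp [beersCurve, WeierstrassCurve.Δ, WeierstrassCurve.b₂, WeierstrassCurve.b₄,
      WeierstrassCurve.b₆, WeierstrassCurve.b₈, h0]

lemma natCast_ne_two [h : (beersCurve p).IsElliptic] : (p : ℚ) ≠ 2 := fun h0 ↦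
  h.isUnit.ne_zero <| by
    simp only [beersCurve, WeierstrassCurve.Δ, WeierstrassCurve.b₂, WeierstrassCurve.b₄,
      WeierstrassCurve.b₆, WeierstrassCurve.b₈, h0]
    norm_num

lemma negY_eq (x y : ℚ) : (beersCurve p).toAffine.negY x y = -y := by
  simp [WeierstrassCurve.Affine.negY, beersCurve]

/-- The line through two points meets the curve in a third one, with ordinate minus that of the
sum; evaluating its equation at a root `e` of the cubic shows that the product of the
three values of `x - e` is a square. -/
lemma isSquare_of_add_eq {x₁ y₁ x₂ y₂ x₃ y₃ e : ℚ}
    {h₁ : (beersCurve p).toAffine.Nonsingular x₁ y₁}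
    {h₂ : (beersCurve p).toAffine.Nonsingular x₂ y₂}
    {h₃ : (beersCurve p).toAffine.Nonsingular x₃ y₃} (hx : x₁ ≠ x₂)
    (h : some x₁ y₁ h₁ + some x₂ y₂ h₂ = some x₃ y₃ h₃) (he : e * (e - p) * (e - 2) = 0) :
    IsSquare ((x₁ - e) * (x₂ - e) * (x₃ - e)) := by
  have e₁ := equation_of_nonsingular h₁
  have e₂ := equation_of_nonsingular h₂
  rw [add_of_X_ne hx, some.injEq] at h
  have hx₃ := h.1
  rw [WeierstrassCurve.Affine.slope_of_X_ne hx, WeierstrassCurve.Affine.addX] at hx₃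
  simp only [beersCurve] at hx₃
  have hl : (y₁ - y₂) / (x₁ - x₂) * (x₁ - x₂) = y₁ - y₂ := div_mul_cancel₀ _ (sub_ne_zero.mpr hx)
  generalize (y₁ - y₂) / (x₁ - x₂) = l at *
  have hg : x₁ ^ 2 + x₁ * x₂ + x₂ ^ 2 - (p + 2) * (x₁ + x₂) + 2 * p = l * (y₁ + y₂) := by
    apply mul_right_cancel₀ (sub_ne_zero.mpr hx)
    linear_combination e₂ - e₁ - (y₁ + y₂) * hl
  refine ⟨l * (e - x₁) + y₁, ?_⟩
  linear_combination (e - x₁) * hg + (e - x₁) * l * hl - (e - x₁) * (e - x₂) * hx₃ - e₁ - he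

lemma add_self_eq_zero_iff {x y : ℚ} (h : (beersCurve p).toAffine.Nonsingular x y) :
    some x y h + some x y h = 0 ↔ y = 0 := by
  constructor
  · intro H
    by_contra hy
    have hy' : y ≠ (beersCurve p).toAffine.negY x y := by
      rw [negY_eq]; intro h'; exact hy (by linarith)
    rw [add_self_of_Y_ne hy'] at H
    exact some_ne_zero _ H
  · rintro rfl
    exact add_self_of_Y_eq (by rw [negY_eq]; simp)

lemma exists_add_self_eq {x y : ℚ} (h : (beersCurve p).toAffine.Nonsingular x y) (hy : y ≠ 0) :
    ∃ (x' y' : ℚ) (h' : (beersCurve p).toAffine.Nonsingular x' y'),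
      some x y h + some x y h = some x' y' h' ∧
      x' = ((3 * x ^ 2 - 2 * (p + 2) * x + 2 * p) / (2 * y)) ^ 2 + (p + 2) - 2 * x := by
  have hy' : y ≠ (beersCurve p).toAffine.negY x y := by
    rw [negY_eq]; intro h'; exact hy (by linarith)
  refine ⟨_, _, _, add_self_of_Y_ne hy', ?_⟩
  rw [WeierstrassCurve.Affine.slope_of_Y_ne rfl hy', negY_eq, WeierstrassCurve.Affine.addX]
  simp only [beersCurve]
  rw [show y - -y = 2 * y by ring]
  ring

/-- The `x`-coordinate of a double, and its difference with the root `2` of the cubic, are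
squares. -/
lemma add_self_x {x y x' y' : ℚ} {h : (beersCurve p).toAffine.Nonsingular x y}
    {h' : (beersCurve p).toAffine.Nonsingular x' y'}
    (H : some x y h + some x y h = some x' y' h') :
    y ≠ 0 ∧ x' = ((x ^ 2 - 2 * p) / (2 * y)) ^ 2 ∧
      x' - 2 = ((x ^ 2 - 4 * x + 2 * p) / (2 * y)) ^ 2 := by
  have hy : y ≠ 0 := fun hy ↦ some_ne_zero h' (H ▸ (add_self_eq_zero_iff h).mpr hy)
  obtain ⟨x'', y'', h'', H'', hx⟩ := exists_add_self_eq h hy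
  rw [H, some.injEq] at H''
  rw [H''.1, hx]
  have e := equation_of_nonsingular h
  refine ⟨hy, ?_, ?_⟩ <;> field_simp
  · linear_combination (4 * (p + 2) - 8 * x) * e
  · linear_combination (4 * (p + 2) - 8 * x - 8) * e

/-- A point at which `x`, `x - p` and `x - 2` are all squares can be halved. -/
lemma exists_add_self_of_squares [(beersCurve p).IsElliptic] {x y s t u : ℚ}
    (h : (beersCurve p).toAffine.Nonsingular x y)
    (hs : x = s ^ 2) (ht : x - p = t ^ 2) (hu : x - 2 = u ^ 2) :
    ∃ Q : BeersGroup p, Q + Q = some x y h := by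
  have hp : (p : ℚ) = s ^ 2 - t ^ 2 := by linarith
  have h2 : (2 : ℚ) = s ^ 2 - u ^ 2 := by linarith
  have hp2 : (2 : ℚ) * p = (s ^ 2 - u ^ 2) * (s ^ 2 - t ^ 2) := by rw [← hp, ← h2]
  have hX : ((s + t) * (s + u) * (t + u)) ^ 2 = (s * s + s * t + s * u + t * u) *
      ((s * s + s * t + s * u + t * u) - p) * ((s * s + s * t + s * u + t * u) - 2) := by
    rw [hp, h2]; ring
  have hY : (s + t) * (s + u) * (t + u) ≠ 0 := by
    refine mul_ne_zero (mul_ne_zero ?_ ?_) ?_ <;> intro h0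
    · exact natCast_ne_zero (p := p) (by rw [hp]; linear_combination (s - t) * h0)
    · exact two_ne_zero (α := ℚ) (by rw [h2]; linear_combination (s - u) * h0)
    · exact natCast_ne_two (p := p) (by linear_combination hp - h2 - (t - u) * h0)
  obtain ⟨x', y', h', H, hx'⟩ := exists_add_self_eq (nonsingular_of_equation hX) hY
  -- The tangent at the halving point has slope `s + t + u`.
  have hslope : 3 * (s * s + s * t + s * u + t * u) ^ 2 -
      2 * (p + 2) * (s * s + s * t + s * u + t * u) + 2 * p =
      (s + t + u) * (2 * ((s + t) * (s + u) * (t + u))) := by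
    linear_combination hp2 - 2 * (s * s + s * t + s * u + t * u) * (hp + h2)
  have hxx : x = x' := by
    rw [hx', hslope, mul_div_cancel_right₀ _ (mul_ne_zero two_ne_zero hY)]
    linear_combination hs - hp - h2
  rcases X_eq_iff (h₁ := h) (h₂ := h') |>.mp hxx with h1 | h1
  · exact ⟨_, H.trans h1.symm⟩
  · exact ⟨-some _ _ (nonsingular_of_equation hX), by rw [← neg_add, H, h1]⟩

/-- The point `(0, 0)` of order two. -/
def T₀ [(beersCurve p).IsElliptic] : BeersGroup p :=
  some 0 0 (nonsingular_of_equation (by ring))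

/-- The point `(p, 0)` of order two. -/
def Tp [(beersCurve p).IsElliptic] : BeersGroup p :=
  some p 0 (nonsingular_of_equation (by ring))

/-- The point `(2, 0)` of order two. -/
def T₂ [(beersCurve p).IsElliptic] : BeersGroup p :=
  some 2 0 (nonsingular_of_equation (by ring))

lemma add_self_eq_zero_iff_mem [(beersCurve p).IsElliptic] (P : BeersGroup p) :
    P + P = 0 ↔ P ∈ ({0, T₀, Tp, T₂} : Finset (BeersGroup p)) := by
  rcases P with _ | ⟨x, y, h⟩
  · simp [← zero_def]
  have e := equation_of_nonsingular h
  rw [add_self_eq_zero_iff]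
  simp only [Finset.mem_insert, Finset.mem_singleton, some_ne_zero, T₀, Tp, T₂, some.injEq,
    false_or]
  constructor
  · rintro rfl
    simp only [and_true]
    have : x * (x - p) * (x - 2) = 0 := by rw [← e]; ring
    rw [mul_eq_zero, mul_eq_zero, sub_eq_zero, sub_eq_zero, or_assoc] at this
    exact this
  · rintro (h | h | h) <;> exact h.2

lemma card_two_torsion [(beersCurve p).IsElliptic] :
    ({0, T₀, Tp, T₂} : Finset (BeersGroup p)).card = 4 := by
  have h0 := natCast_ne_zero (p := p)
  have h2 := natCast_ne_two (p := p)
  rw [Finset.card_insert_of_notMem, Finset.card_insert_of_notMem, Finset.card_insert_of_notMem,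
    Finset.card_singleton]
  · simpa [Tp, T₂] using h2
  · simpa [T₀, Tp, T₂] using h0.symm
  · simp [T₀, Tp, T₂, (some_ne_zero _).symm]

end BeersGroup

/-! ### Parity of valuations and squarefree parts of rational numbers -/

lemma padicValRat_natCast_of_ne {p ℓ : ℕ} (hp : p.Prime) [Fact ℓ.Prime] (h : ℓ ≠ p) :
    padicValRat ℓ (p : ℚ) = 0 := by
  have := Fact.mk hp
  rw [padicValRat.of_nat, padicValNat_primes h, Nat.cast_zero]

lemma padicValRat_sq (ℓ : ℕ) [Fact ℓ.Prime] (a : ℚ) :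
    padicValRat ℓ (a ^ 2) = 2 * padicValRat ℓ a := by
  rw [padicValRat.pow]; norm_num

/-- A nonzero rational number with even valuation at every prime not dividing `n` has absolute
value a divisor of `n` times a square. -/
lemma exists_dvd_abs_eq_mul_sq {x : ℚ} (hx : x ≠ 0) {n : ℕ} (hn : n ≠ 0)
    (h : ∀ ℓ : ℕ, [Fact ℓ.Prime] → ¬ ℓ ∣ n → Even (padicValRat ℓ x)) :
    ∃ d : ℕ, d ∣ n ∧ ∃ s : ℚ, s ≠ 0 ∧ |x| = d * s ^ 2 := by
  obtain ⟨a, b, hab, ha⟩ := Nat.sq_mul_squarefree (x.num.natAbs * x.den)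
  have hden : (x.den : ℚ) ≠ 0 := by exact_mod_cast x.den_ne_zero
  have hm : x.num.natAbs * x.den ≠ 0 :=
    mul_ne_zero (Int.natAbs_ne_zero.mpr (Rat.num_ne_zero.mpr hx)) x.den_ne_zero
  have ha0 : a ≠ 0 := by rintro rfl; exact hm (by rw [← hab]; ring)
  have hb0 : b ≠ 0 := by rintro rfl; exact hm (by rw [← hab]; ring)
  have habs : |x| = a * ((b : ℚ) / x.den) ^ 2 := by
    have h1 : |x| = (x.num.natAbs : ℚ) / x.den := by
      conv_lhs => rw [← Rat.num_div_den x]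
      rw [abs_div, Nat.abs_cast, Nat.cast_natAbs, Int.cast_abs]
    have h2 : (b : ℚ) ^ 2 * a = x.num.natAbs * x.den := by exact_mod_cast hab
    rw [h1]
    field_simp
    linear_combination -h2
  have hs : (b : ℚ) / x.den ≠ 0 := div_ne_zero (by exact_mod_cast hb0) hden
  refine ⟨a, ?_, _, hs, habs⟩
  have hsub : a.primeFactors ⊆ n.primeFactors := by
    intro ℓ hℓ
    have hℓp := Nat.prime_of_mem_primeFactors hℓ
    have := Fact.mk hℓp
    refine Nat.mem_primeFactors.mpr ⟨hℓp, ?_, hn⟩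
    by_contra hndvd
    have hev := h ℓ hndvd
    have hval : padicValRat ℓ |x| = padicValRat ℓ x := by
      rcases abs_choice x with h | h <;> rw [h]
      exact padicValRat.neg x
    have hv1 : padicValNat ℓ a = 1 := by
      rw [← Nat.factorization_def a hℓp]
      exact le_antisymm (ha.natFactorization_le_one ℓ)
        ((hℓp.dvd_iff_one_le_factorization ha0).mp (Nat.dvd_of_mem_primeFactors hℓ))
    rw [← hval, habs, padicValRat.mul (by exact_mod_cast ha0) (pow_ne_zero 2 hs),
      padicValRat_sq, padicValRat.of_nat, hv1] at hev
    revert hev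
    simp [Int.even_add]
  rw [← Nat.prod_primeFactors_of_squarefree ha]
  exact (Finset.prod_dvd_prod_of_subset _ _ _ hsub).trans (Nat.prod_primeFactors_dvd n)

/-- If `a` and `b` are units at `ℓ` and `z (z - a) (z - b)` is a nonzero square, then `z` has even
valuation at `ℓ`. -/
lemma even_padicValRat_of_cubic {ℓ : ℕ} [Fact ℓ.Prime] {z a b y : ℚ} (hy : y ≠ 0) (ha : a ≠ 0)
    (hb : b ≠ 0) (hva : padicValRat ℓ a = 0) (hvb : padicValRat ℓ b = 0)
    (h : y ^ 2 = z * (z - a) * (z - b)) : Even (padicValRat ℓ z) := by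
  have h0 : z * (z - a) * (z - b) ≠ 0 := h ▸ pow_ne_zero 2 hy
  have hzb := right_ne_zero_of_mul h0
  have hza := right_ne_zero_of_mul (left_ne_zero_of_mul h0)
  have hz := left_ne_zero_of_mul (left_ne_zero_of_mul h0)
  have hv := congrArg (padicValRat ℓ) h
  rw [padicValRat_sq, padicValRat.mul (mul_ne_zero hz hza) hzb, padicValRat.mul hz hza] at hv
  have key (c : ℚ) (hc : c ≠ 0) (hvc : padicValRat ℓ c = 0) (hzc : z - c ≠ 0) :
      (padicValRat ℓ z < 0 → padicValRat ℓ (z - c) = padicValRat ℓ z) ∧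
      (0 < padicValRat ℓ z → padicValRat ℓ (z - c) = 0) := by
    have hc' : padicValRat ℓ (-c) = 0 := by rw [padicValRat.neg, hvc]
    constructor <;> intro hlt
    · rw [sub_eq_add_neg] at hzc ⊢
      exact padicValRat.add_eq_of_lt hzc hz (neg_ne_zero.mpr hc) (by rwa [hc'])
    · rw [sub_eq_neg_add] at hzc ⊢
      rw [padicValRat.add_eq_of_lt hzc (neg_ne_zero.mpr hc) hz (by rwa [hc']), hc']
  have hA := key a ha hva hza
  have hB := key b hb hvb hzb
  rcases lt_trichotomy (padicValRat ℓ z) 0 with hlt | heq | hgt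
  · rw [hA.1 hlt, hB.1 hlt] at hv
    exact ⟨padicValRat ℓ y - padicValRat ℓ z, by linarith⟩
  · rw [heq]; exact Even.zero
  · rw [hA.2 hgt, hB.2 hgt] at hv
    exact ⟨padicValRat ℓ y, by linarith⟩

/-- If `a` is a unit and `c` an integer at `ℓ`, and if `z (z + a)` and `z + c` are nonzero squares,
then `z` has even valuation at `ℓ`. -/
lemma even_padicValRat_of_quadratic {ℓ : ℕ} [Fact ℓ.Prime] {z a c y s : ℚ} (hy : y ≠ 0)
    (hs : s ≠ 0) (ha : a ≠ 0) (hc : c ≠ 0) (hva : padicValRat ℓ a = 0) (hvc : 0 ≤ padicValRat ℓ c)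
    (h : y ^ 2 = z * (z + a)) (h' : s ^ 2 = z + c) : Even (padicValRat ℓ z) := by
  have h0 : z * (z + a) ≠ 0 := h ▸ pow_ne_zero 2 hy
  have hza := right_ne_zero_of_mul h0
  have hz := left_ne_zero_of_mul h0
  rcases lt_trichotomy (padicValRat ℓ z) 0 with hlt | heq | hgt
  · have hv := congrArg (padicValRat ℓ) h'
    rw [padicValRat_sq, padicValRat.add_eq_of_lt (h' ▸ pow_ne_zero 2 hs) hz hc
      (hlt.trans_le hvc)] at hv
    exact ⟨padicValRat ℓ s, by linarith⟩
  · rw [heq]; exact Even.zero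
  · have hv := congrArg (padicValRat ℓ) h
    rw [padicValRat_sq, padicValRat.mul hz hza] at hv
    rw [add_comm z, padicValRat.add_eq_of_lt (by rwa [add_comm]) ha hz (by rwa [hva]), hva] at hv
    exact ⟨padicValRat ℓ y, by linarith⟩

/-- If `c` is not a square modulo `ℓ`, then the values of the form `s² - c` have even valuation
at `ℓ`. -/
lemma even_padicValRat_sq_sub {ℓ : ℕ} [Fact ℓ.Prime] {c : ℤ} (hc : ¬ IsSquare (c : ZMod ℓ))
    (s : ℚ) : Even (padicValRat ℓ (s ^ 2 - c)) := by
  have hden : (s.den : ℚ) ≠ 0 := by exact_mod_cast s.den_ne_zero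
  have hndvd : ¬ (ℓ : ℤ) ∣ s.num ^ 2 - c * s.den ^ 2 := by
    intro hdvd
    rw [← ZMod.intCast_zmod_eq_zero_iff_dvd] at hdvd
    push_cast at hdvd
    by_cases hd : (s.den : ZMod ℓ) = 0
    · rw [hd] at hdvd
      have hn : (s.num : ZMod ℓ) = 0 := by simpa using hdvd
      rw [ZMod.natCast_eq_zero_iff] at hd
      rw [ZMod.intCast_zmod_eq_zero_iff_dvd, Int.natCast_dvd] at hn
      exact Nat.not_coprime_of_dvd_of_dvd (Fact.out : ℓ.Prime).one_lt hn hd s.reduced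
    · refine hc ⟨s.num / s.den, ?_⟩
      field_simp
      linear_combination -hdvd
  have hne : s.num ^ 2 - c * s.den ^ 2 ≠ 0 := fun h ↦ hndvd (h ▸ dvd_zero _)
  have heq : s ^ 2 - c = ((s.num ^ 2 - c * s.den ^ 2 : ℤ) : ℚ) / (s.den : ℚ) ^ 2 := by
    conv_lhs => rw [← Rat.num_div_den s]
    push_cast
    field_simp
  rw [heq, padicValRat.div (by exact_mod_cast hne) (pow_ne_zero 2 hden), padicValRat_sq,
    padicValRat.of_int, padicValInt.eq_zero_of_not_dvd hndvd]
  simp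

/-- Since `(s - u) (s + u) = 2`, the valuations of the two factors have different parity, so that
of their sum `2 s` is at most `0`. -/
lemma padicValRat_two_neg_of_sq_sub_sq {s u : ℚ} (hs : s ≠ 0) (h : s ^ 2 - u ^ 2 = 2) :
    padicValRat 2 s < 0 := by
  have h1 : (s - u) * (s + u) = 2 := by linear_combination h
  have h0 : (s - u) * (s + u) ≠ 0 := by rw [h1]; norm_num
  have ha := left_ne_zero_of_mul h0
  have hb := right_ne_zero_of_mul h0
  have h2 : padicValRat 2 (2 : ℚ) = 1 := by
    exact_mod_cast padicValRat.self (p := 2) (by norm_num)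
  have hv := congrArg (padicValRat 2) h1
  rw [padicValRat.mul ha hb, h2] at hv
  have hsum : (s - u) + (s + u) = 2 * s := by ring
  have hmin := padicValRat.add_eq_min (p := 2) (q := s - u) (r := s + u)
    (by rw [hsum]; exact mul_ne_zero two_ne_zero hs) ha hb (by omega)
  rw [hsum, padicValRat.mul two_ne_zero hs, h2] at hmin
  omega


namespace BeersGroup

/-! ### Torsion of the Mordell-Weil group -/

variable {p : ℕ}

/-- A nonzero double `(x, y)` has `x` nonintegral at `2`: both `x` and `x - 2` are squares, and
these squares differ by `2`. -/
lemma padicValRat_two_neg_of_add_self [(beersCurve p).IsElliptic] {P : BeersGroup p} {x y : ℚ}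
    {h : (beersCurve p).toAffine.Nonsingular x y} (H : P + P = some x y h) :
    padicValRat 2 x < 0 := by
  rcases P with _ | ⟨x₀, y₀, h₀⟩
  · rw [← zero_def, add_zero] at H
    exact absurd H.symm (some_ne_zero h)
  obtain ⟨-, h1, h2⟩ := add_self_x H
  rw [h1, padicValRat_sq]
  have h3 : ((x₀ ^ 2 - 2 * p) / (2 * y₀)) ^ 2 - ((x₀ ^ 2 - 4 * x₀ + 2 * p) / (2 * y₀)) ^ 2 = 2 := by
    rw [← h1, ← h2]; ring
  have hne : (x₀ ^ 2 - 2 * p) / (2 * y₀) ≠ 0 := by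
    intro h0
    rw [h0] at h3
    nlinarith [sq_nonneg ((x₀ ^ 2 - 4 * x₀ + 2 * p) / (2 * y₀))]
  have := padicValRat_two_neg_of_sq_sub_sq hne h3
  linarith

lemma padicValRat_sub_natCast {x : ℚ} (hx : padicValRat 2 x < 0) (n : ℕ) :
    x - n ≠ 0 ∧ padicValRat 2 (x - n) = padicValRat 2 x := by
  have hx0 : x ≠ 0 := by rintro rfl; simp at hx
  have hn : 0 ≤ padicValRat 2 (-(n : ℚ)) := by rw [padicValRat.neg, padicValRat.of_nat]; positivity
  have hne : x - n ≠ 0 := by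
    intro h0
    rw [sub_eq_zero.mp h0, padicValRat.of_nat] at hx
    omega
  refine ⟨hne, ?_⟩
  rcases eq_or_ne (n : ℚ) 0 with h0 | h0
  · rw [h0, sub_zero]
  rw [sub_eq_add_neg] at hne ⊢
  exact padicValRat.add_eq_of_lt hne hx0 (neg_ne_zero.mpr h0) (hx.trans_le hn)

/-- Near the point at infinity of the `2`-adic points, doubling lowers the valuation of `x`
by `2`. -/
lemma exists_add_self_of_padicValRat_neg {x y : ℚ}
    (h : (beersCurve p).toAffine.Nonsingular x y) (hx : padicValRat 2 x < 0) :
    ∃ (x' y' : ℚ) (h' : (beersCurve p).toAffine.Nonsingular x' y'),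
      some x y h + some x y h = some x' y' h' ∧ padicValRat 2 x' = padicValRat 2 x - 2 := by
  have e := equation_of_nonsingular h
  have hx0 : x ≠ 0 := by rintro rfl; simp at hx
  obtain ⟨hp0, hp⟩ := padicValRat_sub_natCast hx p
  obtain ⟨h20, h2⟩ := padicValRat_sub_natCast hx 2
  push_cast at h20 h2
  have hy : y ≠ 0 := by
    rintro rfl
    exact mul_ne_zero (mul_ne_zero hx0 hp0) h20 (by rw [← e]; ring)
  obtain ⟨x', y', h', H, -⟩ := exists_add_self_eq h hy
  obtain ⟨-, H', -⟩ := add_self_x H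
  refine ⟨x', y', h', H, ?_⟩
  have hv := congrArg (padicValRat 2) e
  rw [padicValRat_sq, padicValRat.mul (mul_ne_zero hx0 hp0) h20, padicValRat.mul hx0 hp0, hp,
    h2] at hv
  have hxsq : padicValRat 2 (x ^ 2) < 0 := by rw [padicValRat_sq]; linarith
  obtain ⟨hn0, hn⟩ := padicValRat_sub_natCast hxsq (2 * p)
  push_cast at hn0 hn
  have hself : padicValRat 2 (2 : ℚ) = 1 := by
    exact_mod_cast padicValRat.self (p := 2) (by norm_num)
  rw [H', padicValRat_sq, padicValRat.div hn0 (mul_ne_zero two_ne_zero hy), hn, padicValRat_sq,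
    padicValRat.mul two_ne_zero hy, hself]
  linarith

/-- The doubles form a torsion-free group, since the valuation at `2` of `x` strictly decreases
under repeated doubling. -/
lemma add_self_eq_zero_of_isOfFinAddOrder [(beersCurve p).IsElliptic] {P : BeersGroup p}
    (hP : IsOfFinAddOrder P) : P + P = 0 := by
  rcases hQ : P + P with _ | ⟨x, y, h⟩
  · rfl
  exfalso
  have hx := padicValRat_two_neg_of_add_self hQ
  have key (k : ℕ) : ∃ (x' y' : ℚ) (h' : (beersCurve p).toAffine.Nonsingular x' y'),
      (2 ^ k * 2) • P = some x' y' h' ∧ padicValRat 2 x' = padicValRat 2 x - 2 * k := by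
    induction k with
    | zero => exact ⟨x, y, h, by rw [← hQ, pow_zero, one_mul, two_nsmul], by simp⟩
    | succ k ih =>
      obtain ⟨x', y', h', H, hv⟩ := ih
      obtain ⟨x'', y'', h'', H', hv'⟩ :=
        exists_add_self_of_padicValRat_neg h' (by rw [hv]; linarith)
      refine ⟨x'', y'', h'', ?_, by rw [hv', hv]; push_cast; ring⟩
      rw [pow_succ', mul_assoc, mul_comm 2, mul_nsmul, H, two_nsmul, H']
  have hinj : Function.Injective fun k : ℕ ↦ (2 ^ k * 2) • P := by
    intro k l hkl
    obtain ⟨x₁, y₁, h₁, H₁, hv₁⟩ := key k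
    obtain ⟨x₂, y₂, h₂, H₂, hv₂⟩ := key l
    simp only [H₁, H₂, some.injEq] at hkl
    rw [hkl.1, hv₂] at hv₁
    omega
  exact Set.infinite_of_injective_forall_mem hinj
    (fun k ↦ (AddSubmonoid.mem_multiples_iff _ _).mpr ⟨_, rfl⟩) hP.finite_multiples

/-! ### The complete `2`-descent -/

/-- Adding a point `(a, 0)` of order two multiplies the class of `x` modulo squares by `a`. -/
lemma exists_add_two_torsion {x y a : ℚ} (h : (beersCurve p).toAffine.Nonsingular x y) (hy : y ≠ 0)
    (h' : (beersCurve p).toAffine.Nonsingular a 0) :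
    ∃ (x' y' : ℚ) (h'' : (beersCurve p).toAffine.Nonsingular x' y'), y' ≠ 0 ∧
      some x y h + some a 0 h' = some x' y' h'' ∧ IsSquare (x * a * x') := by
  have e := equation_of_nonsingular h
  have hT := (add_self_eq_zero_iff h').mpr rfl
  have hx : x ≠ a := by
    rintro rfl
    have e' := equation_of_nonsingular h'
    exact pow_ne_zero 2 hy (by rw [e, ← e']; ring)
  rcases hR : some x y h + some a 0 h' with _ | ⟨x', y', h''⟩
  · have h1 := add_eq_zero_iff_eq_neg.mp hR
    rw [WeierstrassCurve.Affine.Point.neg_some, some.injEq] at h1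
    exact absurd h1.1 hx
  refine ⟨x', y', h'', ?_, rfl, ?_⟩
  · rw [ne_eq, ← add_self_eq_zero_iff h'', ← hR, add_add_add_comm, hT, add_zero,
      add_self_eq_zero_iff]
    exact hy
  · simpa using isSquare_of_add_eq hx hR (e := 0) (by ring)

lemma pos_of_equation {x y : ℚ} (hp : 2 ≤ p) (hy : y ≠ 0) (e : y ^ 2 = x * (x - p) * (x - 2)) :
    0 < x := by
  have hp' : (2 : ℚ) ≤ p := by exact_mod_cast hp
  by_contra hx
  have : x * (x - p) * (x - 2) ≤ 0 := by
    have : 0 ≤ (x - p) * (x - 2) := by nlinarith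
    nlinarith
  have := pow_pos (abs_pos.mpr hy) 2
  rw [sq_abs] at this
  linarith

/-- Up to squares, `x` is one of `1`, `2`, `p`, `2 p`. -/
lemma exists_x_eq_mul_sq (hp : p.Prime) (hp2 : p ≠ 2) {x y : ℚ} (hy : y ≠ 0)
    (e : y ^ 2 = x * (x - p) * (x - 2)) :
    ∃ d : ℕ, (d = 1 ∨ d = 2 ∨ d = p ∨ d = 2 * p) ∧ ∃ s : ℚ, s ≠ 0 ∧ x = d * s ^ 2 := by
  have hx := pos_of_equation hp.two_le hy e
  obtain ⟨d, hd, s, hs, H⟩ := exists_dvd_abs_eq_mul_sq hx.ne' (n := 2 * p)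
    (mul_ne_zero two_ne_zero hp.ne_zero) (fun ℓ _ hℓ ↦ by
      have hℓ2 : ℓ ≠ 2 := by rintro rfl; exact hℓ (dvd_mul_right _ _)
      have hℓp : ℓ ≠ p := by rintro rfl; exact hℓ (dvd_mul_left _ _)
      exact even_padicValRat_of_cubic hy (by exact_mod_cast hp.ne_zero) two_ne_zero
        (padicValRat_natCast_of_ne hp hℓp)
        (by exact_mod_cast padicValRat_natCast_of_ne Nat.prime_two hℓ2) e)
  rw [abs_of_pos hx] at H
  refine ⟨d, ?_, s, hs, H⟩
  obtain ⟨a, b, ha, hb, rfl⟩ := (Nat.dvd_mul.mp hd)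
  rcases (Nat.dvd_prime Nat.prime_two).mp ha with rfl | rfl <;>
    rcases (Nat.dvd_prime hp).mp hb with rfl | rfl <;> simp

/-- Every point of order other than `1` and `2` can be translated by a point of order dividing two
so that `x` becomes a square. -/
lemma exists_add_eq_isSquare [(beersCurve p).IsElliptic] (hp : p.Prime) (hp2 : p ≠ 2) {x y : ℚ}
    (h : (beersCurve p).toAffine.Nonsingular x y) (hy : y ≠ 0) :
    ∃ T : BeersGroup p, T + T = 0 ∧
      ∃ (x' y' s : ℚ) (h' : (beersCurve p).toAffine.Nonsingular x' y'), y' ≠ 0 ∧ s ≠ 0 ∧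
        some x y h + T = some x' y' h' ∧ x' = s ^ 2 := by
  have hp0 : (p : ℚ) ≠ 0 := natCast_ne_zero
  have hT₂ : (T₂ : BeersGroup p) + T₂ = 0 := (add_self_eq_zero_iff _).mpr rfl
  have hTp : (Tp : BeersGroup p) + Tp = 0 := (add_self_eq_zero_iff _).mpr rfl
  -- Translation by `(a, 0)` turns a point with `x` in the class `a b` into one in the class `b`.
  have step (x y a b s : ℚ) (h : (beersCurve p).toAffine.Nonsingular x y) (hy : y ≠ 0) (ha : a ≠ 0)
      (hb : b ≠ 0) (hs : s ≠ 0) (h' : (beersCurve p).toAffine.Nonsingular a 0)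
      (hx : x = b * a * s ^ 2) :
      ∃ (x' y' s' : ℚ) (h'' : (beersCurve p).toAffine.Nonsingular x' y'), y' ≠ 0 ∧ s' ≠ 0 ∧
        some x y h + some a 0 h' = some x' y' h'' ∧ x' = b * s' ^ 2 := by
    obtain ⟨x', y', h'', hy', H, r, hr⟩ := exists_add_two_torsion h hy h'
    have hx' : x' = b * (r / (a * b * s)) ^ 2 := by
      rw [hx] at hr
      field_simp
      linear_combination hr
    have hx0 : x' ≠ 0 := by
      rintro rfl
      exact pow_ne_zero 2 hy' (by rw [equation_of_nonsingular h'']; ring)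
    refine ⟨x', y', _, h'', hy', ?_, H, hx'⟩
    intro h0
    rw [h0] at hx'
    exact hx0 (by rw [hx']; ring)
  obtain ⟨d, hd, s, hs, hx⟩ := exists_x_eq_mul_sq hp hp2 hy (equation_of_nonsingular h)
  rcases hd with rfl | rfl | rfl | rfl
  · exact ⟨0, add_zero 0, x, y, s, h, hy, hs, add_zero _, by rw [hx]; push_cast; ring⟩
  · obtain ⟨x', y', s', h', hy', hs', H, hx'⟩ := step x y 2 1 s h hy two_ne_zero one_ne_zero hs
      (nonsingular_of_equation (by ring)) (by rw [hx]; push_cast; ring)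
    exact ⟨T₂, hT₂, x', y', s', h', hy', hs', H, by rw [hx']; ring⟩
  · obtain ⟨x', y', s', h', hy', hs', H, hx'⟩ := step x y d 1 s h hy hp0 one_ne_zero hs
      (nonsingular_of_equation (by ring)) (by rw [hx]; ring)
    exact ⟨Tp, hTp, x', y', s', h', hy', hs', H, by rw [hx']; ring⟩
  · obtain ⟨x', y', s', h', hy', hs', H, hx'⟩ := step x y p 2 s h hy hp0 two_ne_zero hs
      (nonsingular_of_equation (by ring)) (by rw [hx]; push_cast; ring)
    obtain ⟨x'', y'', s'', h'', hy'', hs'', H', hx''⟩ := step x' y' 2 1 s' h' hy' two_ne_zero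
      one_ne_zero hs' (nonsingular_of_equation (by ring)) (by rw [hx']; ring)
    refine ⟨Tp + T₂, by rw [add_add_add_comm, hTp, hT₂, add_zero], x'', y'', s'', h'', hy'', hs'',
      ?_, by rw [hx'']; ring⟩
    rw [← add_assoc]
    exact (congrArg (· + T₂) H).trans H'

/-- The points at which `x`, `x - p`, `x - 2` lie in the classes of `1`, `-1`, `-1` modulo squares.
Up to points of order two this is the only nontrivial class of the `2`-descent that the local
conditions may leave. -/
def IsNegClass (P : BeersGroup p) : Prop :=
  ∃ (x y s t u : ℚ) (h : (beersCurve p).toAffine.Nonsingular x y), P = some x y h ∧ y ≠ 0 ∧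
    x = s ^ 2 ∧ x - p = -t ^ 2 ∧ x - 2 = -u ^ 2

/-- The local conditions: if `x` is a square, then up to squares `x - p` and `x - 2` agree with a
divisor of `p - 2` up to sign. As `2` is not a square modulo `p - 2`, this divisor is `1`; and the
sign is positive if `-1` is not a square modulo `p`. -/
lemma isSquare_or_neg_of_isSquare (hp : p.Prime) (hq : (p - 2).Prime)
    (h8 : p % 8 = 7 ∨ p % 8 = 5) {x y s : ℚ} (hy : y ≠ 0) (hs : s ≠ 0)
    (e : y ^ 2 = x * (x - p) * (x - 2)) (hx : x = s ^ 2) :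
    (∃ t u : ℚ, x - p = t ^ 2 ∧ x - 2 = u ^ 2) ∨
      p % 8 = 5 ∧ ∃ t u : ℚ, x - p = -t ^ 2 ∧ x - 2 = -u ^ 2 := by
  have hp5 : 5 ≤ p := by omega
  have hqc : ((p - 2 : ℕ) : ℚ) = p - 2 := by push_cast [show 2 ≤ p by omega]; ring
  have := Fact.mk hp
  have := Fact.mk hq
  have hprod : x * (x - p) * (x - 2) ≠ 0 := e ▸ pow_ne_zero 2 hy
  have hx2 := right_ne_zero_of_mul hprod
  have hxp := right_ne_zero_of_mul (left_ne_zero_of_mul hprod)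
  have hys : (y / s) ^ 2 = (x - p) * (x - p + (p - 2 : ℕ)) := by
    have hx0 := left_ne_zero_of_mul (left_ne_zero_of_mul hprod)
    rw [div_pow, e, hqc, ← hx]
    field_simp
    ring
  obtain ⟨d, hd, t, ht, H⟩ := exists_dvd_abs_eq_mul_sq hxp hq.ne_zero (fun ℓ _ hℓ ↦ by
    refine even_padicValRat_of_quadratic (div_ne_zero hy hs) hs (by exact_mod_cast hq.ne_zero)
      (c := p) (by exact_mod_cast hp.ne_zero) (padicValRat_natCast_of_ne hq ?_) ?_ hys ?_
    · rintro rfl; exact hℓ dvd_rfl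
    · rw [padicValRat.of_nat]; positivity
    · rw [← hx]; ring)
  -- Up to squares, `x - 2` lies in the same class as `x - p`.
  have hu (c : ℚ) (hc : x - p = c * t ^ 2) : x - 2 = c * (y / s / (c * t)) ^ 2 := by
    have hc0 : c ≠ 0 := by rintro rfl; exact hxp (by rw [hc]; ring)
    have h1 : x - 2 = (y / s) ^ 2 / (x - p) := by
      rw [hys, hqc]; field_simp; ring
    rw [h1, hc]
    field_simp
  have hd1 : d = 1 := by
    refine ((Nat.dvd_prime hq).mp hd).resolve_right ?_
    rintro rfl
    have hval (c : ℚ) (hc : c = (p - 2 : ℕ) ∨ c = -(p - 2 : ℕ)) (hcx : x - p = c * t ^ 2) :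
        False := by
      have h1 := hu c hcx
      have hv : padicValRat (p - 2) c = 1 := by
        have h2 := padicValRat.self (p := p - 2) hq.one_lt
        rcases hc with rfl | rfl
        · exact h2
        · rwa [padicValRat.neg]
      have hc0 : c ≠ 0 := by rintro rfl; simp at hv
      have hr : y / s / (c * t) ≠ 0 := by positivity
      have hnsq : ¬ IsSquare ((2 : ℤ) : ZMod (p - 2)) := by
        rw [Int.cast_ofNat, ZMod.exists_sq_eq_two_iff (by omega)]
        omega
      have hev := even_padicValRat_sq_sub hnsq s
      rw [← hx, Int.cast_ofNat, h1, padicValRat.mul hc0 (pow_ne_zero 2 hr), padicValRat_sq,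
        hv] at hev
      revert hev
      simp [Int.even_add]
    rcases abs_choice (x - p) with h | h <;> rw [h] at H
    · exact hval _ (.inl rfl) H
    · exact hval _ (.inr rfl) (by linear_combination -H)
  rw [hd1, Nat.cast_one, one_mul] at H
  rcases abs_choice (x - p) with h | h <;> rw [h] at H
  · have := hu 1 (by rw [H]; ring)
    exact .inl ⟨t, _, H, this.trans (one_mul _)⟩
  · have hneg : x - p = -1 * t ^ 2 := by linear_combination -H
    have := hu _ hneg
    refine .inr ⟨?_, t, _, by rw [hneg]; ring, this.trans (neg_one_mul _)⟩
    refine h8.resolve_left fun h7 ↦ ?_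
    have hnsq : ¬ IsSquare ((-1 : ℤ) : ZMod p) := by
      rw [Int.cast_neg, Int.cast_one, ZMod.exists_sq_eq_neg_one_iff]
      omega
    have hev := even_padicValRat_sq_sub hnsq (s / t)
    have hval : (s / t) ^ 2 - ((-1 : ℤ) : ℚ) = p / t ^ 2 := by
      push_cast
      field_simp
      linear_combination hneg - hx
    rw [hval, padicValRat.div (by exact_mod_cast hp.ne_zero) (pow_ne_zero 2 ht), padicValRat_sq,
      padicValRat.self hp.one_lt] at hev
    revert hev
    simp [Int.even_sub]

lemma exists_two_torsion_add [(beersCurve p).IsElliptic] (hp : p.Prime) (hq : (p - 2).Prime)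
    (h8 : p % 8 = 7 ∨ p % 8 = 5) (P : BeersGroup p) :
    ∃ T : BeersGroup p, T + T = 0 ∧
      ((∃ Q, P + T = Q + Q) ∨ p % 8 = 5 ∧ IsNegClass (P + T)) := by
  by_cases h0 : P + P = 0
  · exact ⟨P, h0, .inl ⟨0, by rw [h0, add_zero]⟩⟩
  rcases P with _ | ⟨x, y, h⟩
  · exact absurd rfl h0
  rw [add_self_eq_zero_iff] at h0
  obtain ⟨T, hT, x', y', s, h', hy', hs, H, hx'⟩ :=
    exists_add_eq_isSquare hp (by omega) h h0
  refine ⟨T, hT, ?_⟩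
  rw [H]
  rcases isSquare_or_neg_of_isSquare hp hq h8 hy' hs (equation_of_nonsingular h') hx' with
    ⟨t, u, ht, hu⟩ | ⟨h5, t, u, ht, hu⟩
  · obtain ⟨Q, hQ⟩ := exists_add_self_of_squares h' hx' ht hu
    exact .inl ⟨Q, hQ.symm⟩
  · exact .inr ⟨h5, x', y', s, t, u, h', rfl, hy', hx', ht, hu⟩

lemma IsNegClass.exists_sub_eq [(beersCurve p).IsElliptic] {P P' : BeersGroup p}
    (hP : IsNegClass P) (hP' : IsNegClass P') : ∃ Q, P - P' = Q + Q := by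
  obtain ⟨x, y, s, t, u, h, rfl, hy, hs, ht, hu⟩ := hP
  obtain ⟨x', y', s', t', u', h', rfl, hy', hs', ht', hu'⟩ := hP'
  by_cases hx : x = x'
  · rcases X_eq_iff (h₁ := h) (h₂ := h') |>.mp hx with H | H
    · exact ⟨0, by rw [H, sub_self, add_zero]⟩
    · exact ⟨some x y h, by
        conv_lhs => rw [← neg_neg (some x' y' h'), ← H]
        exact sub_neg_eq_add _ _⟩
  rcases hR : some x y h - some x' y' h' with _ | ⟨x₃, y₃, h₃⟩
  · exact ⟨0, by rw [← zero_def, add_zero]⟩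
  rw [sub_eq_add_neg, WeierstrassCurve.Affine.Point.neg_some] at hR
  have e := equation_of_nonsingular h
  have e' := equation_of_nonsingular h'
  have h0 := pow_ne_zero 2 hy
  have h0' := pow_ne_zero 2 hy'
  rw [e, hu, ht, hs] at h0
  rw [e', hu', ht', hs'] at h0'
  have key (a b c v w : ℚ) (hv : v ≠ 0) (hw : w ≠ 0) (hab : a * b = v ^ 2 * w ^ 2)
      (hc : IsSquare (a * b * c)) : ∃ r, c = r ^ 2 := by
    obtain ⟨r, hr⟩ := hc
    refine ⟨r / (v * w), ?_⟩
    rw [hab] at hr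
    field_simp
    linear_combination hr
  obtain ⟨r₀, hr₀⟩ := key _ _ _ s s' (by rintro rfl; exact h0 (by ring))
    (by rintro rfl; exact h0' (by ring)) (by rw [hs, hs']; ring)
    (isSquare_of_add_eq hx hR (e := 0) (by ring))
  obtain ⟨r₁, hr₁⟩ := key _ _ _ t t' (by rintro rfl; exact h0 (by ring))
    (by rintro rfl; exact h0' (by ring)) (by rw [ht, ht']; ring)
    (isSquare_of_add_eq hx hR (e := p) (by ring))
  obtain ⟨r₂, hr₂⟩ := key _ _ _ u u' (by rintro rfl; exact h0 (by ring))
    (by rintro rfl; exact h0' (by ring)) (by rw [hu, hu']; ring)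
    (isSquare_of_add_eq hx hR (e := 2) (by ring))
  obtain ⟨Q, hQ⟩ := exists_add_self_of_squares h₃ (by rw [← hr₀]; ring) hr₁ hr₂
  exact ⟨Q, hQ.symm⟩

end BeersGroup


/-! ### Finitely generated abelian groups with small quotient modulo doubling -/

/-- A free abelian group of finite rank with at most two classes modulo doubling has rank at
most one. -/
lemma finrank_le_one_of_two_classes {M : Type*} [AddCommGroup M] [Module.Finite ℤ M]
    [Module.Free ℤ M] (m₀ : M) (h : ∀ m : M, ∃ q, m = q + q ∨ m = m₀ + (q + q)) :
    Module.finrank ℤ M ≤ 1 := by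
  by_contra! hlt
  let b := Module.finBasis ℤ M
  let i : Fin (Module.finrank ℤ M) := ⟨0, by omega⟩
  let j : Fin (Module.finrank ℤ M) := ⟨1, by omega⟩
  have hij : j ≠ i := by simp [i, j]
  have hne (k : Fin (Module.finrank ℤ M)) (q : M) : b k ≠ q + q := by
    intro hk
    have := congrArg (fun m ↦ b.repr m k) hk
    simp at this
    omega
  obtain ⟨q, hq⟩ := h (b i)
  obtain ⟨q', hq'⟩ := h (b j)
  have hq := hq.resolve_left (hne i q)
  have hq' := hq'.resolve_left (hne j q')
  have hsub : b i - b j = (q - q') + (q - q') := by rw [hq, hq']; abel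
  have := congrArg (fun m ↦ b.repr m i) hsub
  simp [hij] at this
  omega

/-- A free abelian group of finite rank in which every element is a double is trivial. -/
lemma finrank_eq_zero_of_two_divisible {M : Type*} [AddCommGroup M] [Module.Finite ℤ M]
    [Module.Free ℤ M] (h : ∀ m : M, ∃ q, m = q + q) : Module.finrank ℤ M = 0 := by
  by_contra hne
  let b := Module.finBasis ℤ M
  obtain ⟨q, hq⟩ := h (b ⟨0, by omega⟩)
  have := congrArg (fun m ↦ b.repr m ⟨0, by omega⟩) hq
  simp at this
  omega

/-- A finitely generated abelian group is the product of its torsion and of its free quotient. -/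
lemma nonempty_addEquiv_torsion_prod (G : Type*) [AddCommGroup G] [Module.Finite ℤ G] :
    Nonempty (G ≃+ (G ⧸ Submodule.torsion ℤ G) × Submodule.torsion ℤ G) := by
  obtain ⟨g, hg⟩ := (Submodule.torsion ℤ G).mkQ.exists_rightInverse_of_surjective
    (Submodule.range_mkQ _)
  have hex : Function.Exact (Submodule.torsion ℤ G).subtype (Submodule.torsion ℤ G).mkQ := by
    rw [LinearMap.exact_iff]; simp
  obtain ⟨e, -⟩ := hex.splitSurjectiveEquiv (Submodule.injective_subtype _) ⟨g, hg⟩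
  exact ⟨(e.trans (LinearEquiv.prodComm ℤ _ _)).toAddEquiv⟩

namespace BeersGroup

variable {p : ℕ}

/-! ### The structure of the Mordell-Weil group -/

lemma mem_torsion_iff [(beersCurve p).IsElliptic] (P : BeersGroup p) :
    P ∈ Submodule.torsion ℤ (BeersGroup p) ↔ P + P = 0 := by
  rw [← Submodule.mem_toAddSubgroup, Submodule.torsion_int]
  refine ⟨add_self_eq_zero_of_isOfFinAddOrder, fun h ↦ ?_⟩
  exact isOfFinAddOrder_iff_nsmul_eq_zero.mpr ⟨2, two_pos, by rw [two_nsmul, h]⟩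

lemma nonempty_torsion_addEquiv [(beersCurve p).IsElliptic] :
    Nonempty (Submodule.torsion ℤ (BeersGroup p) ≃+ ZMod 2 × ZMod 2) := by
  have hcard : Nat.card (Submodule.torsion ℤ (BeersGroup p)) = 4 := by
    have hset : (Submodule.torsion ℤ (BeersGroup p) : Set (BeersGroup p)) =
        ({0, T₀, Tp, T₂} : Finset (BeersGroup p)) := by
      ext P
      rw [SetLike.mem_coe, mem_torsion_iff, add_self_eq_zero_iff_mem, Finset.mem_coe]
    rw [← card_two_torsion (p := p), ← Set.ncard_coe_finset, ← hset]
    rfl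
  have hexp : AddMonoid.exponent (Submodule.torsion ℤ (BeersGroup p)) = 2 := by
    refine ((Nat.dvd_prime Nat.prime_two).mp
      (AddMonoid.exponent_dvd_of_forall_nsmul_eq_zero fun P ↦ ?_)).resolve_left fun h1 ↦ ?_
    · ext
      rw [two_nsmul]
      exact (mem_torsion_iff _).mp P.2
    · have := AddMonoid.exp_eq_one_iff.mp h1
      rw [Nat.card_of_subsingleton 0] at hcard
      omega
  have : IsAddKleinFour (Submodule.torsion ℤ (BeersGroup p)) := ⟨hcard, hexp⟩
  exact IsAddKleinFour.nonempty_addEquiv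

/-- Mordell's theorem for these curves, by descent along the naive height. -/
lemma finite_of_two_classes [(beersCurve p).IsElliptic] (P₀ : BeersGroup p)
    (h : ∀ P : BeersGroup p, ∃ T, T + T = 0 ∧ ∃ Q, P = T + (Q + Q) ∨ P = T + (P₀ + (Q + Q))) :
    Module.Finite ℤ (BeersGroup p) := by
  obtain ⟨C, hC⟩ := WeierstrassCurve.Affine.Point.abs_logHeight_xRep_add_sub_le
    (W := (beersCurve p).toAffine)
  have := WeierstrassCurve.Affine.Point.northcott_logHeight_xRep (W := (beersCurve p).toAffine)
  let E : Finset (BeersGroup p) := {0, T₀, Tp, T₂}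
  let s : Finset (BeersGroup p) := E ∪ E.image (· + P₀)
  refine Module.Finite.iff_addGroup_fg.mpr (AddCommGroup.fg_of_descent' (C := C) ?_
    (fun P ↦ Height.logHeight_nonneg P.xRep) hC)
  have hsurj : Function.Surjective fun t : s ↦
      (QuotientAddGroup.mk t.1 : BeersGroup p ⧸ (nsmulAddMonoidHom (α := BeersGroup p) 2).range) := by
    intro m
    obtain ⟨P, rfl⟩ := QuotientAddGroup.mk_surjective m
    obtain ⟨T, hT, Q, hQ⟩ := h P
    have hTE : T ∈ E := (add_self_eq_zero_iff_mem T).mp hT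
    have hQ2 : Q + Q ∈ (nsmulAddMonoidHom (α := BeersGroup p) 2).range := ⟨Q, two_nsmul Q⟩
    rcases hQ with hQ | hQ
    · refine ⟨⟨T, Finset.mem_union_left _ hTE⟩, QuotientAddGroup.eq.mpr ?_⟩
      rwa [hQ, neg_add_cancel_left]
    · refine ⟨⟨T + P₀, Finset.mem_union_right _ (Finset.mem_image_of_mem _ hTE)⟩,
        QuotientAddGroup.eq.mpr ?_⟩
      rwa [hQ, ← add_assoc T, neg_add_cancel_left]
  have := Finite.of_surjective _ hsurj
  exact AddSubgroup.finiteIndex_of_finite_quotient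

/-- Every class modulo doubling and torsion is that of a multiple of one point `P₀`, which can be
taken to be `0` if `p ≡ 7 [MOD 8]`. -/
lemma exists_two_classes [(beersCurve p).IsElliptic] (hp : p.Prime) (hq : (p - 2).Prime)
    (h8 : p % 8 = 7 ∨ p % 8 = 5) : ∃ P₀ : BeersGroup p, (p % 8 = 7 → P₀ = 0) ∧
      ∀ P : BeersGroup p, ∃ T, T + T = 0 ∧ ∃ Q, P = T + (Q + Q) ∨ P = T + (P₀ + (Q + Q)) := by
  have key (P : BeersGroup p) : ∃ T, T + T = 0 ∧
      ((∃ Q, P = T + (Q + Q)) ∨ p % 8 = 5 ∧ ∃ P', IsNegClass P' ∧ P = T + P') := by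
    obtain ⟨T, hT, h⟩ := exists_two_torsion_add hp hq h8 P
    have hP : P = T + (P + T) := by rw [add_left_comm, hT, add_zero]
    refine ⟨T, hT, h.imp ?_ ?_⟩
    · rintro ⟨Q, hQ⟩
      exact ⟨Q, by rw [← hQ]; exact hP⟩
    · rintro ⟨h5, hneg⟩
      exact ⟨h5, _, hneg, hP⟩
  by_cases hex : p % 8 = 5 ∧ ∃ P₀ : BeersGroup p, IsNegClass P₀
  · obtain ⟨h5, P₀, hP₀⟩ := hex
    refine ⟨P₀, by omega, fun P ↦ ?_⟩
    obtain ⟨T, hT, ⟨Q, hQ⟩ | ⟨-, P', hP', H⟩⟩ := key P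
    · exact ⟨T, hT, Q, .inl hQ⟩
    · obtain ⟨Q, hQ⟩ := hP'.exists_sub_eq hP₀
      exact ⟨T, hT, Q, .inr (by rw [H, ← hQ, add_sub_cancel])⟩
  · refine ⟨0, fun _ ↦ rfl, fun P ↦ ?_⟩
    obtain ⟨T, hT, ⟨Q, hQ⟩ | ⟨h5, P', hP', -⟩⟩ := key P
    · exact ⟨T, hT, Q, .inl hQ⟩
    · exact absurd ⟨h5, P', hP'⟩ hex

/-- The structure of the Mordell-Weil group follows from the classes modulo doubling and
torsion. -/
theorem structure_of_two_classes [(beersCurve p).IsElliptic] (P₀ : BeersGroup p)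
    (h : ∀ P : BeersGroup p, ∃ T, T + T = 0 ∧ ∃ Q, P = T + (Q + Q) ∨ P = T + (P₀ + (Q + Q))) :
    Module.Finite ℤ (BeersGroup p) ∧ Module.finrank ℤ (BeersGroup p) ≤ 1 ∧
      (P₀ = 0 → Module.finrank ℤ (BeersGroup p) = 0) ∧
      (Module.finrank ℤ (BeersGroup p) = 0 → Nonempty (BeersGroup p ≃+ ZMod 2 × ZMod 2)) ∧
      (Module.finrank ℤ (BeersGroup p) = 1 → Nonempty (BeersGroup p ≃+ ℤ × ZMod 2 × ZMod 2)) := by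
  have hfin := finite_of_two_classes P₀ h
  obtain ⟨e⟩ := nonempty_addEquiv_torsion_prod (BeersGroup p)
  obtain ⟨f⟩ := nonempty_torsion_addEquiv (p := p)
  rw [← finrank_quotient_eq_of_le_torsion (le_refl (Submodule.torsion ℤ (BeersGroup p)))]
  have hquot (m : BeersGroup p ⧸ Submodule.torsion ℤ (BeersGroup p)) :
      ∃ q, m = q + q ∨ m = Submodule.Quotient.mk P₀ + (q + q) := by
    obtain ⟨P, rfl⟩ := Submodule.Quotient.mk_surjective _ m
    obtain ⟨T, hT, Q, hQ⟩ := h P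
    have hT0 : (Submodule.Quotient.mk T : BeersGroup p ⧸ Submodule.torsion ℤ (BeersGroup p)) = 0 :=
      (Submodule.Quotient.mk_eq_zero _).mpr ((mem_torsion_iff T).mpr hT)
    refine ⟨Submodule.Quotient.mk Q, hQ.imp ?_ ?_⟩ <;> rintro rfl <;> simp [hT0]
  refine ⟨hfin, finrank_le_one_of_two_classes _ hquot, fun h0 ↦ ?_, fun h0 ↦ ?_, fun h1 ↦ ?_⟩
  · refine finrank_eq_zero_of_two_divisible fun m ↦ (hquot m).imp fun q hq ↦ ?_
    rcases hq with hq | hq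
    · exact hq
    · rwa [h0, Submodule.Quotient.mk_zero, zero_add] at hq
  · have := Module.finrank_zero_iff.mp h0
    have := Unique.mk' (BeersGroup p ⧸ Submodule.torsion ℤ (BeersGroup p))
    exact ⟨e.trans (AddEquiv.uniqueProd.trans f)⟩
  · have g := LinearEquiv.ofFinrankEq (BeersGroup p ⧸ Submodule.torsion ℤ (BeersGroup p)) ℤ
      (h1.trans (Module.finrank_self ℤ).symm)
    exact ⟨e.trans (g.toAddEquiv.prodCongr f)⟩

end BeersGroup

theorem theorem1 (p : ℕ) (hp : p.Prime) (hp2 : (p - 2).Prime) :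
    (p % 8 = 7 →
      Module.Finite ℤ (BeersGroup p) ∧ Module.finrank ℤ (BeersGroup p) = 0 ∧
        Nonempty (BeersGroup p ≃+ ZMod 2 × ZMod 2)) ∧
    (p % 8 = 5 →
      Module.Finite ℤ (BeersGroup p) ∧ Module.finrank ℤ (BeersGroup p) ≤ 1 ∧
        (Nonempty (BeersGroup p ≃+ ZMod 2 × ZMod 2) ∨
          Nonempty (BeersGroup p ≃+ ℤ × ZMod 2 × ZMod 2))) := by
  have hne : p ≠ 2 := by rintro rfl; exact Nat.not_prime_zero hp2
  have := beersCurve_isElliptic p hp.ne_zero hne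
  constructor
  · intro h7
    obtain ⟨P₀, hP₀, h⟩ := BeersGroup.exists_two_classes hp hp2 (.inl h7)
    obtain ⟨hfin, -, hrank, hequiv, -⟩ := BeersGroup.structure_of_two_classes P₀ h
    exact ⟨hfin, hrank (hP₀ h7), hequiv (hrank (hP₀ h7))⟩
  · intro h5
    obtain ⟨P₀, -, h⟩ := BeersGroup.exists_two_classes hp hp2 (.inr h5)
    obtain ⟨hfin, hle, -, hequiv₀, hequiv₁⟩ := BeersGroup.structure_of_two_classes P₀ h
    exact ⟨hfin, hle, (Nat.le_one_iff_eq_zero_or_eq_one.mp hle).imp hequiv₀ hequiv₁⟩
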